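/- A \emph{financial system} on the set of banks $N=\{1,\dots,n\}$ consists of external assets $e_i\in\mathbb{Q}_{\ge 0}$, debt contracts with notionals $c_{i,j}\in\mathbb{Q}_{\ge 0}$ (debtor $i$, creditor $j$, with $c_{i,i}=0$), and credit default swaps (CDSes) with notionals $c_{i,j}^k\in\mathbb{Q}_{\ge 0}$ (debtor $i$, creditor $j$, reference bank $k$, with $c_{i,j}^k=0$ unless $i,j,k$ are distinct); a contract exists iff its notional is positive. For $r\in[0,1]^N$ put $l_{i,j}(r)=c_{i,j}+\sum_{k}(1-r_k)c_{i,j}^k$, $l_i(r)=\sum_j l_{i,j}(r)$ and $a_i(r)=e_i+\sum_j r_j\,l_{j,i}(r)$. The vector $r\in[0,1]^N$ is \emph{clearing} if for every $i$: $r_i=\min\{1,a_i(r)/l_i(r)\}$ when $l_i(r)>0$, and $r_i=1$ when $l_i(r)=0$. The system is \emph{non-degenerate} if every debtor of a CDS has positive external assets or is the debtor of a debt contract, and every reference bank of a CDS is the debtor of a debt contract. The \emph{auxiliary graph} is the directed graph on $N$ with a blue arc $(i,j)$ whenever $c_{i,j}\neq 0$, an orange arc $(i,j)$ whenever $c_{i,j}^k\ne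 0$ for some $k$, and a red arc $(k,i)$ whenever $c_{i,j}^k\neq 0$ for some $j$ (at most one arc of each colour for each ordered pair of banks). A bank is \emph{switched on} if it has at least two incoming red arcs, or exactly one incoming red arc and at least one outgoing blue arc. A directed cycle of the auxiliary graph is \emph{weakly switched} if it contains a red arc $(u,v)$ such that $v$ is switched on. \textbf{Theorem.} Let $I$ be a non-degenerate financial system whose auxiliary graph has no weakly switched cycle. Then $I$ has a clearing vector all of whose entries are rational. Moreover, if $I$ has only finitely many clearing vectors (in particular, if the clearing vector is unique), then all clearing vectors of $I$ are rational. -/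

import Mathlib

/-- A financial system on the banks `Fin n`: external assets, debt contracts and credit default
swaps (CDSes), all with non-negative rational coefficients. A notional `0` means that there is no
such contract. No bank has a debt contract with itself, and the three banks of a CDS are
distinct. -/
structure FinancialSystem (n : ℕ) where
  /-- external assets of a bank -/
  ext : Fin n → ℚ
  /-- `debt i j`: notional of the debt contract with debtor `i` and creditor `j` -/
  debt : Fin n → Fin n → ℚ
  /-- `cds i j k`: notional of the CDS with debtor `i`, creditor `j` and reference bank `k` -/
  cds : Fin n → Fin n → Fin n → ℚ
  ext_nonneg : ∀ i, 0 ≤ ext i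
  debt_nonneg : ∀ i j, 0 ≤ debt i j
  cds_nonneg : ∀ i j k, 0 ≤ cds i j k
  debt_self : ∀ i, debt i i = 0
  cds_eq_zero : ∀ i j k, i = j ∨ i = k ∨ j = k → cds i j k = 0

namespace FinancialSystem

variable {n : ℕ} (I : FinancialSystem n)

/-- The liability of bank `i` to bank `j` under the recovery rates `r`. -/
noncomputable def liabilityTo (r : Fin n → ℝ) (i j : Fin n) : ℝ :=
  (I.debt i j : ℝ) + ∑ k, (1 - r k) * (I.cds i j k : ℝ)

/-- The total liabilities of bank `i`. -/
noncomputable def liabilities (r : Fin n → ℝ) (i : Fin n) : ℝ :=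
  ∑ j, I.liabilityTo r i j

/-- The payment that bank `i` makes to bank `j`. -/
noncomputable def payment (r : Fin n → ℝ) (i j : Fin n) : ℝ :=
  r i * I.liabilityTo r i j

/-- The assets of bank `i`: external assets and incoming payments. -/
noncomputable def assets (r : Fin n → ℝ) (i : Fin n) : ℝ :=
  (I.ext i : ℝ) + ∑ j, I.payment r j i

/-- `r` is a clearing recovery rate vector. -/
def IsClearing (r : Fin n → ℝ) : Prop :=
  (∀ i, 0 ≤ r i ∧ r i ≤ 1) ∧
  ∀ i, (0 < I.liabilities r i → r i = min 1 (I.assets r i / I.liabilities r i)) ∧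
    (I.liabilities r i = 0 → r i = 1)

/-- Every CDS debtor has positive external assets or is the debtor of a debt contract, and every
reference bank of a CDS is the debtor of a debt contract. -/
def IsNonDegenerate : Prop :=
  (∀ i, (∃ j k, 0 < I.cds i j k) → 0 < I.ext i ∨ ∃ j, 0 < I.debt i j) ∧
  (∀ k, (∃ i j, 0 < I.cds i j k) → ∃ j, 0 < I.debt k j)

/-- The colours of the arcs of the auxiliary graph. -/
inductive Colour
  | blue
  | orange
  | red

/-- `I.AuxArc t u v`: the auxiliary graph has an arc from `u` to `v` of colour `t`. Blue arcs run
from debtor to creditor of a debt contract, orange arcs from debtor to creditor of a CDS, and red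
arcs from the reference bank to the debtor of a CDS. There is at most one arc of each colour
between an ordered pair of nodes. -/
def AuxArc : Colour → Fin n → Fin n → Prop
  | .blue, u, v => I.debt u v ≠ 0
  | .orange, u, v => ∃ k, I.cds u v k ≠ 0
  | .red, u, v => ∃ j, I.cds v j u ≠ 0

/-- The number of red arcs into `i`. -/
noncomputable def redInDegree (i : Fin n) : ℕ :=
  {u : Fin n | I.AuxArc .red u i}.ncard

/-- A node is switched on if it has more than one incoming red arc, or exactly one incoming red arc
and at least one outgoing blue arc. -/
def IsSwitchedOn (i : Fin n) : Prop :=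
  1 < I.redInDegree i ∨ (I.redInDegree i = 1 ∧ ∃ j, I.AuxArc .blue i j)

/-- A directed cycle of the auxiliary graph, with `m + 1` distinct nodes and a chosen coloured arc
from each node to the next; the addition on `Fin (m + 1)` is cyclic. -/
structure AuxCycle where
  m : ℕ
  node : Fin (m + 1) → Fin n
  colour : Fin (m + 1) → Colour
  node_injective : Function.Injective node
  arc : ∀ t, I.AuxArc (colour t) (node t) (node (t + 1))

/-- A cycle is weakly switched if it has a red arc whose head is switched on. -/
def AuxCycle.IsWeaklySwitched {I : FinancialSystem n} (C : I.AuxCycle) : Prop :=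
  ∃ t, C.colour t = .red ∧ I.IsSwitchedOn (C.node (t + 1))

end FinancialSystem

/-- All coordinates of the real vector `r` are rational numbers. -/
def IsRationalVector {n : ℕ} (r : Fin n → ℝ) : Prop :=
  ∀ i, ∃ q : ℚ, r i = (q : ℝ)

/-!
The auxiliary graph is worked through one strongly connected component at a time, from the
sources on. Suppose that `r` is clearing, that `r` is rational on a set `S` of banks closed under
predecessors, and that `U` is `S` together with one further component. A red arc inside this
component lies on a cycle, so its head is not switched on. Each bank of `U` is therefore of one of
two kinds (`IsSwitchFreeExtension.rat_or_not_switchedOn`): either all reference banks of its CDSes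
lie in `S`, so that its liabilities are rational numbers, or it has a single reference bank and no
debt, so that it pays its creditors in fixed rational proportions
(`liabilityTo_mul_eq_of_not_isSwitchedOn`). By non-degeneracy a reference bank has debts, hence is
of the first kind. Consequently, in terms of the total payments `p i = r i * l i`, the clearing
equations on `U` read `p i = min (l i) (a i)`, where `l i` and `a i` are affine functions of `p`
with rational coefficients.

A `ℚ`-linear map `φ : ℝ → ℝ` with `φ 1 = 1` commutes with such affine functions, and it commutes
with the minima that occur as soon as it does not reverse the order of `l i` and `a i`; then it
maps solutions to solutions (`clearsAt_transport`). There is a sequence of such maps with rational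
values that converges pointwise to the identity (`exists_seq_ratLinear_tendsto_id`: perturb a basis
of `ℝ` over `ℚ` that contains `1`), so the solution on `U` is a limit of rational solutions on `U`.
Each of these extends to a clearing vector by Brouwer's fixed-point theorem
(`exists_clearsAt_compl`). The outcome is `exists_isClearing_rat_near`, which gives a rational
clearing vector by induction over the components. If there are only finitely many clearing
vectors, then each coordinate of a clearing vector is a limit of elements of a finite set of
rational numbers, hence rational.

Brouwer's theorem is proved by the method of Milnor and Rogers. If `x + h x` were a `C¹` retraction
of the unit ball onto the sphere, then `x + t • h x` would permute the ball for small `t ≥ 0`,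
so the integral over the ball of its Jacobian determinant, a polynomial in `t`, would be constantly
the volume of the ball; but for `t = 1` the determinant vanishes.
-/

section

open Metric Set MeasureTheory Filter Topology

/-! ### Brouwer's fixed-point theorem -/

section Brouwer

variable {E : Type*} [NormedAddCommGroup E] [InnerProductSpace ℝ E] [FiniteDimensional ℝ E]

theorem exists_polynomial_eval_eq_det_one_add_smul (A : E →L[ℝ] E) :
    ∃ p : Polynomial ℝ, p.natDegree ≤ Module.finrank ℝ E ∧
      ∀ t : ℝ, p.eval t = (ContinuousLinearMap.id ℝ E + t • A).det := by
  classical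
  let b := Module.finBasis ℝ E
  let M := LinearMap.toMatrix b b (A : E →ₗ[ℝ] E)
  refine ⟨Matrix.det ((Polynomial.X : Polynomial ℝ) • M.map Polynomial.C +
    (1 : Matrix _ _ ℝ).map Polynomial.C), ?_, fun t => ?_⟩
  · simpa using Polynomial.natDegree_det_X_add_C_le M 1
  · have h : (ContinuousLinearMap.id ℝ E + t • A).det =
        LinearMap.det (LinearMap.id + t • (A : E →ₗ[ℝ] E)) := rfl
    rw [h, ← LinearMap.det_toMatrix b, map_add, map_smul, LinearMap.toMatrix_id,
      ← Polynomial.coe_evalRingHom, RingHom.map_det]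
    congr 1
    ext i j
    simp [M, Matrix.one_apply, apply_ite, add_comm, mul_comm t]

/-- For small `t ≥ 0` the map `x ↦ x + t • h x` permutes the open unit ball, if `h` is Lipschitz
and vanishes on the sphere: it is a Lipschitz-small perturbation of the identity, hence injective
and open, and its image is relatively closed in the connected ball. -/
theorem image_ball_add_smul_eq_ball {h : E → E} {L : NNReal}
    (hL : LipschitzOnWith L h (closedBall 0 1)) (h0 : ∀ x, ‖x‖ = 1 → h x = 0)
    (hb : ∀ x ∈ closedBall (0 : E) 1, ‖x + h x‖ ≤ 1)
    {t : ℝ} (ht0 : 0 ≤ t) (ht1 : t < 1) (htL : t * L < 1) :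
    InjOn (fun x => x + t • h x) (ball 0 1) ∧
      (fun x => x + t • h x) '' ball 0 1 = ball 0 1 := by
  set g : E → E := fun x => x + t • h x with hg
  have happ : ApproximatesLinearOn g (ContinuousLinearEquiv.refl ℝ E : E →L[ℝ] E)
      (closedBall 0 1) (t.toNNReal * L) := by
    intro x hx y hy
    have := hL.norm_sub_le hx hy
    have e : g x - g y - (ContinuousLinearEquiv.refl ℝ E : E →L[ℝ] E) (x - y)
        = t • (h x - h y) := by simp [hg, smul_sub]; abel
    rw [e, norm_smul, Real.norm_of_nonneg ht0, NNReal.coe_mul, Real.coe_toNNReal _ ht0, mul_assoc]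
    gcongr
  have hc1 : t.toNNReal * L < 1 := by
    rw [← NNReal.coe_lt_coe]; simpa [ht0] using htL
  have hc : Subsingleton E ∨ t.toNNReal * L <
      ‖((ContinuousLinearEquiv.refl ℝ E).symm : E →L[ℝ] E)‖₊⁻¹ := by
    rcases subsingleton_or_nontrivial E with hE | hE
    · exact Or.inl hE
    · right
      have : ‖((ContinuousLinearEquiv.refl ℝ E).symm : E →L[ℝ] E)‖₊ = 1 := by
        have : ((ContinuousLinearEquiv.refl ℝ E).symm : E →L[ℝ] E)
          = ContinuousLinearMap.id ℝ E := rfl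
        rw [this]; exact ContinuousLinearMap.nnnorm_id
      rwa [this, inv_one]
  have happ' := happ.mono_set ball_subset_closedBall
  have hmaps : ∀ x ∈ ball (0 : E) 1, g x ∈ ball (0 : E) 1 := by
    intro x hx
    have h1 := hb x (ball_subset_closedBall hx)
    have e : g x = (1 - t) • x + t • (x + h x) := by
      simp only [hg, smul_add, sub_smul, one_smul]; abel
    rw [mem_ball_zero_iff] at hx ⊢
    calc ‖g x‖ ≤ (1 - t) * ‖x‖ + t * ‖x + h x‖ := by
          rw [e]
          refine (norm_add_le _ _).trans ?_
          rw [norm_smul, norm_smul, Real.norm_of_nonneg ht0,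
            Real.norm_of_nonneg (by linarith : 0 ≤ 1 - t)]
      _ ≤ (1 - t) * ‖x‖ + t * 1 := by gcongr
      _ < (1 - t) * 1 + t * 1 := by nlinarith
      _ = 1 := by ring
  refine ⟨happ'.injOn hc, ?_⟩
  have hopen : IsOpen (g '' ball 0 1) := by
    refine happ'.open_image (ContinuousLinearEquiv.refl ℝ E).toNonlinearRightInverse isOpen_ball ?_
    exact hc
  have hcont : ContinuousOn g (closedBall 0 1) := happ.continuousOn
  have hcomp : IsCompact (g '' closedBall 0 1) :=
    (isCompact_closedBall _ _).image_of_continuousOn hcont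
  -- The image is open, and closed relative to the ball because the sphere is fixed pointwise.
  have heq : g '' ball 0 1 = g '' closedBall 0 1 ∩ ball 0 1 := by
    ext y
    constructor
    · rintro ⟨x, hx, rfl⟩
      exact ⟨⟨x, ball_subset_closedBall hx, rfl⟩, hmaps x hx⟩
    · rintro ⟨⟨x, hx, rfl⟩, hy⟩
      refine ⟨x, ?_, rfl⟩
      rw [mem_closedBall_zero_iff] at hx
      rw [mem_ball_zero_iff] at hy ⊢
      refine lt_of_le_of_ne hx fun h1 => ?_
      simp [hg, h0 x h1, h1] at hy
  refine Subset.antisymm (by rw [heq]; exact inter_subset_right) ?_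
  have hpre : IsPreconnected (ball (0 : E) 1) := (convex_ball _ _).isPreconnected
  refine hpre.subset_of_closure_inter_subset hopen ⟨g 0, hmaps 0 (by simp), 0, by simp, rfl⟩ ?_
  rintro y ⟨hy, hyb⟩
  rw [heq]
  refine ⟨?_, hyb⟩
  exact hcomp.isClosed.closure_subset_iff.mpr (image_mono ball_subset_closedBall) hy

variable [MeasurableSpace E] [BorelSpace E]

/-- There is no `C¹` retraction of the closed unit ball onto the unit sphere. -/
theorem not_exists_contDiff_retraction_sphere {g : E → E} {g' : E → E →L[ℝ] E}
    (hg : ∀ x ∈ closedBall (0 : E) 1, HasFDerivAt g (g' x) x)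
    (hg' : ContinuousOn g' (closedBall 0 1)) (hid : ∀ x, ‖x‖ = 1 → g x = x)
    (hnorm : ∀ x ∈ closedBall (0 : E) 1, ‖g x‖ = 1) : False := by
  set A : E → E →L[ℝ] E := fun x => g' x - ContinuousLinearMap.id ℝ E with hA
  have hAc : ContinuousOn A (closedBall 0 1) := hg'.sub continuousOn_const
  have hh : ∀ x ∈ closedBall (0 : E) 1, HasFDerivAt (fun y => g y - y) (A x) x := fun x hx =>
    (hg x hx).sub (hasFDerivAt_id x)
  obtain ⟨C, hC⟩ := (isCompact_closedBall (0 : E) 1).exists_bound_of_continuousOn hAc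
  set L : NNReal := ⟨max C 0, le_max_right _ _⟩
  have hAL : ∀ x ∈ closedBall (0 : E) 1, ‖A x‖ ≤ L := fun x hx =>
    (hC x hx).trans (le_max_left _ _)
  have hLip : LipschitzOnWith L (fun y => g y - y) (closedBall 0 1) :=
    (convex_closedBall _ _).lipschitzOnWith_of_nnnorm_hasFDerivWithin_le
      (fun x hx => (hh x hx).hasFDerivWithinAt) (fun x hx => hAL x hx)
  -- On a short interval of parameters the Jacobian determinant is positive.
  obtain ⟨δ, hδ, hdet⟩ : ∃ δ > 0, ∀ B : E →L[ℝ] E, ‖B‖ < δ →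
      0 < (ContinuousLinearMap.id ℝ E + B).det := by
    have hc : Continuous fun B : E →L[ℝ] E => (ContinuousLinearMap.id ℝ E + B).det :=
      ContinuousLinearMap.continuous_det.comp (continuous_const.add continuous_id)
    have h1 : (0 : ℝ) < (ContinuousLinearMap.id ℝ E + (0 : E →L[ℝ] E)).det := by
      rw [add_zero]
      have : (ContinuousLinearMap.id ℝ E).det = 1 := LinearMap.det_id
      rw [this]; exact one_pos
    have := hc.continuousAt.eventually (lt_mem_nhds h1)
    obtain ⟨δ, hδ, hB⟩ := Metric.eventually_nhds_iff.mp this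
    exact ⟨δ, hδ, fun B hB' => hB (by simpa [dist_eq_norm] using hB')⟩
  set d := Module.finrank ℝ E
  set η : ℝ := min δ 1 / (2 * (L + 1)) with hη
  have hL0 : (0 : ℝ) ≤ L := L.2
  have hηpos : 0 < η := by positivity
  have hηδ : η * (L + 1) < δ := by
    have : η * (L + 1) = min δ 1 / 2 := by rw [hη]; field_simp
    rw [this]
    have : min δ 1 ≤ δ := min_le_left _ _
    linarith
  have hη1 : η * (L + 1) < 1 := by
    have : η * (L + 1) = min δ 1 / 2 := by rw [hη]; field_simp
    rw [this]
    have : min δ 1 ≤ 1 := min_le_right _ _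
    linarith
  have hint : ∀ t : ℝ, IntegrableOn (fun x => (ContinuousLinearMap.id ℝ E + t • A x).det)
      (ball (0 : E) 1) volume := by
    intro t
    have : ContinuousOn (fun x => (ContinuousLinearMap.id ℝ E + t • A x).det)
        (closedBall (0 : E) 1) :=
      ContinuousLinearMap.continuous_det.comp_continuousOn
        (continuousOn_const.add (hAc.const_smul t))
    exact (this.integrableOn_compact (isCompact_closedBall _ _)).mono_set ball_subset_closedBall
  have hsmall : ∀ t : ℝ, 0 ≤ t → t ≤ η →
      ∫ x in ball (0 : E) 1, (ContinuousLinearMap.id ℝ E + t • A x).det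
        = volume.real (ball (0 : E) 1) := by
    intro t ht0 htη
    have htL : t * (L + 1) < 1 := lt_of_le_of_lt (by gcongr) hη1
    have htδ : t * (L + 1) < δ := lt_of_le_of_lt (by gcongr) hηδ
    obtain ⟨hinj, him⟩ := image_ball_add_smul_eq_ball hLip (fun x hx => by simp [hid x hx])
      (fun x hx => by simp [hnorm x hx]) ht0 (by nlinarith) (by nlinarith)
    have hder : ∀ x ∈ ball (0 : E) 1, HasFDerivWithinAt (fun x => x + t • (g x - x))
        (ContinuousLinearMap.id ℝ E + t • A x) (ball 0 1) x := fun x hx =>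
      ((hasFDerivAt_id x).add
        ((hh x (ball_subset_closedBall hx)).const_smul t)).hasFDerivWithinAt
    have hpos : ∀ x ∈ ball (0 : E) 1, 0 < (ContinuousLinearMap.id ℝ E + t • A x).det := by
      intro x hx
      refine hdet _ ?_
      rw [norm_smul, Real.norm_of_nonneg ht0]
      have := hAL x (ball_subset_closedBall hx)
      nlinarith
    have key := integral_image_eq_integral_abs_det_fderiv_smul volume measurableSet_ball hder hinj
      (fun _ => (1 : ℝ))
    rw [him] at key
    simp only [integral_const, smul_eq_mul, mul_one, measureReal_restrict_apply_univ] at key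
    rw [key]
    refine setIntegral_congr_fun measurableSet_ball fun x hx => ?_
    rw [abs_of_pos (hpos x hx)]
  -- Interpolating at `d + 1` small parameters determines the integral at parameter `1`.
  set v : ℕ → ℝ := fun j => η * (j / (d + 1)) with hv
  set s : Finset ℕ := Finset.range (d + 1)
  have hvinj : Set.InjOn v s := by
    intro i _ j _ hij
    have h1 : (i : ℝ) / (d + 1) = j / (d + 1) := mul_left_cancel₀ hηpos.ne' hij
    have h2 : ((d : ℝ) + 1) ≠ 0 := by positivity
    exact_mod_cast (div_left_inj' h2).mp h1
  have hexp : ∀ x, (ContinuousLinearMap.id ℝ E + (1 : ℝ) • A x).det =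
      ∑ j ∈ s, (ContinuousLinearMap.id ℝ E + v j • A x).det *
        (Lagrange.basis s v j).eval 1 := by
    intro x
    obtain ⟨p, hpd, hp⟩ := exists_polynomial_eval_eq_det_one_add_smul (A x)
    have hdeg : p.degree < s.card := by
      refine lt_of_le_of_lt Polynomial.degree_le_natDegree ?_
      simp only [s, Finset.card_range]
      exact_mod_cast Nat.lt_succ_of_le hpd
    have := congrArg (Polynomial.eval 1) (Lagrange.eq_interpolate hvinj hdeg)
    rw [hp, Lagrange.interpolate_apply, Polynomial.eval_finsetSum] at this
    rw [this]
    refine Finset.sum_congr rfl fun j _ => ?_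
    simp [hp]
  have hone : ∫ x in ball (0 : E) 1, (ContinuousLinearMap.id ℝ E + (1 : ℝ) • A x).det
      = volume.real (ball (0 : E) 1) := by
    rw [integral_congr_ae (ae_of_all _ hexp)]
    rw [integral_finsetSum _ fun j _ => (hint (v j)).mul_const _]
    have hval : ∀ j ∈ s, ∫ x in ball (0 : E) 1, (ContinuousLinearMap.id ℝ E + v j • A x).det *
        (Lagrange.basis s v j).eval 1
        = volume.real (ball (0 : E) 1) * (Lagrange.basis s v j).eval 1 := by
      intro j hj
      rw [integral_mul_const, hsmall (v j) (by positivity) ?_]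
      have hj' : (j : ℝ) ≤ d + 1 := by
        have := Finset.mem_range.mp hj
        exact_mod_cast this.le
      have : (j : ℝ) / (d + 1) ≤ 1 := (div_le_one (by positivity)).mpr hj'
      simp only [hv]
      nlinarith
    rw [Finset.sum_congr rfl hval, ← Finset.mul_sum, ← Polynomial.eval_finsetSum,
      Lagrange.sum_basis hvinj ⟨0, by simp [s]⟩, Polynomial.eval_one, mul_one]
  -- At parameter `1` the map takes values in the sphere, so its derivative is singular.
  have hzero : ∀ x ∈ ball (0 : E) 1, (ContinuousLinearMap.id ℝ E + (1 : ℝ) • A x).det = 0 := by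
    intro x hx
    have e : ContinuousLinearMap.id ℝ E + (1 : ℝ) • A x = g' x := by simp [hA]
    rw [e]
    have hgx := hg x (ball_subset_closedBall hx)
    have hin : ∀ w, inner ℝ (g x) (g' x w) = 0 := by
      have h1 : HasFDerivAt (fun y => ‖g y‖ ^ 2) (2 • (innerSL ℝ (g x)).comp (g' x)) x :=
        hgx.norm_sq
      have h2 : HasFDerivAt (fun y => ‖g y‖ ^ 2) (0 : E →L[ℝ] ℝ) x := by
        refine (hasFDerivAt_const (1 : ℝ) x).congr_of_eventuallyEq ?_
        filter_upwards [isOpen_ball.mem_nhds hx] with y hy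
        simp [hnorm y (ball_subset_closedBall hy)]
      intro w
      have := congrArg (fun T : E →L[ℝ] ℝ => T w) (h1.unique h2)
      simpa using this
    by_contra hne
    have hsurj : Function.Surjective (g' x) := by
      have hu : IsUnit (LinearMap.det (g' x : E →ₗ[ℝ] E)) := isUnit_iff_ne_zero.mpr hne
      have := (LinearMap.equivOfIsUnitDet hu).surjective
      intro y
      obtain ⟨z, hz⟩ := this y
      exact ⟨z, by simpa using hz⟩
    obtain ⟨w, hw⟩ := hsurj (g x)
    have := hin w
    rw [hw, real_inner_self_eq_norm_sq, hnorm x (ball_subset_closedBall hx)] at this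
    norm_num at this
  have hz : ∫ x in ball (0 : E) 1, (ContinuousLinearMap.id ℝ E + (1 : ℝ) • A x).det = 0 := by
    rw [setIntegral_congr_fun measurableSet_ball hzero]; simp
  have hvol : 0 < volume.real (ball (0 : E) 1) :=
    ENNReal.toReal_pos (measure_ball_pos _ _ one_pos).ne' measure_ball_lt_top.ne
  linarith
/-- A `C¹` map into the unit ball without fixed points would give a retraction `g` of the ball onto
the sphere: `g x` is the point where the ray from `f x` through `x` leaves the ball. -/
theorem exists_fixedPoint_of_contDiff {E : Type*} [NormedAddCommGroup E] [InnerProductSpace ℝ E]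
    [FiniteDimensional ℝ E] {f : E → E} (hf : ContDiff ℝ 1 f) (hb : ∀ x, ‖f x‖ ≤ 1) :
    ∃ x, f x = x := by
  by_contra! hne
  borelize E
  set u : E → E := fun x => x - f x with hu
  set b : E → ℝ := fun x => inner ℝ x (u x) with hbdef
  set D : E → ℝ := fun x => b x ^ 2 + ‖u x‖ ^ 2 * (1 - ‖x‖ ^ 2) with hD
  -- `s x` is the larger root of `‖x + s • u x‖ ^ 2 = 1`, and `4 * D x` is the discriminant.
  set s : E → ℝ := fun x => (-b x + √(D x)) / ‖u x‖ ^ 2 with hs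
  set g : E → E := fun x => x + s x • u x with hg
  have hupos : ∀ x, 0 < ‖u x‖ ^ 2 := fun x => by
    have : u x ≠ 0 := sub_ne_zero.mpr (hne x).symm
    positivity
  have hbpos : ∀ x, ‖x‖ = 1 → 0 < b x := fun x hx => by
    have h1 : ‖f x‖ ^ 2 = ‖x‖ ^ 2 - 2 * b x + ‖u x‖ ^ 2 := by
      have : f x = x - u x := by simp [hu]
      rw [this, norm_sub_sq_real]
    have h2 : ‖f x‖ ^ 2 ≤ 1 := by
      have := hb x
      have := norm_nonneg (f x)
      nlinarith
    have := hupos x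
    rw [hx] at h1
    linarith
  have hDpos : ∀ x ∈ closedBall (0 : E) 1, 0 < D x := fun x hx => by
    rw [mem_closedBall_zero_iff] at hx
    rcases hx.eq_or_lt with h | h
    · have := hbpos x h
      simp only [hD, h]
      nlinarith
    · have h1 : 0 < 1 - ‖x‖ ^ 2 := by
        have := norm_nonneg x
        nlinarith
      have := hupos x
      simp only [hD]
      positivity
  have hcu : ContDiff ℝ 1 u := contDiff_id.sub hf
  have hcb : ContDiff ℝ 1 b := contDiff_id.inner ℝ hcu
  have hcD : ContDiff ℝ 1 D :=
    (hcb.pow 2).add ((hcu.norm_sq ℝ).mul (contDiff_const.sub (contDiff_id.norm_sq ℝ)))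
  have hcg : ∀ x ∈ closedBall (0 : E) 1, ContDiffAt ℝ 1 g x := fun x hx =>
    contDiffAt_id.add (((hcb.contDiffAt.neg.add (hcD.contDiffAt.sqrt (hDpos x hx).ne')).div
      (hcu.norm_sq ℝ).contDiffAt (hupos x).ne').smul hcu.contDiffAt)
  refine not_exists_contDiff_retraction_sphere (g := g) (g' := fderiv ℝ g)
    (fun x hx => ((hcg x hx).differentiableAt one_ne_zero).hasFDerivAt)
    (fun x hx => ?_) (fun x hx => ?_) (fun x hx => ?_)
  · exact ((hcg x hx).fderiv_right (m := 0) (by simp)).continuousAt.continuousWithinAt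
  · have h1 : √(D x) = b x := by
      have : D x = b x ^ 2 := by simp [hD, hx]
      rw [this, Real.sqrt_sq (hbpos x hx).le]
    simp [hg, hs, h1]
  · have h1 : √(D x) ^ 2 = D x := Real.sq_sqrt (hDpos x hx).le
    have h2 : s x * ‖u x‖ ^ 2 = -b x + √(D x) := div_mul_cancel₀ _ (hupos x).ne'
    have h3 : ‖g x‖ ^ 2 = 1 := by
      simp only [hg]
      rw [norm_add_sq_real, norm_smul, inner_smul_right, mul_pow, Real.norm_eq_abs, sq_abs]
      change ‖x‖ ^ 2 + 2 * (s x * b x) + s x ^ 2 * ‖u x‖ ^ 2 = 1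
      have h4 : (s x * ‖u x‖ ^ 2 + b x) ^ 2 = b x ^ 2 + ‖u x‖ ^ 2 * (1 - ‖x‖ ^ 2) := by
        rw [h2, neg_add_eq_sub, sub_add_cancel, h1]
      have h5 := (hupos x).ne'
      apply mul_left_cancel₀ h5
      linear_combination h4
    have := norm_nonneg (g x)
    nlinarith

/-- **Brouwer's fixed-point theorem**, for maps defined on the whole space. -/
theorem exists_fixedPoint_of_continuous {E : Type*} [NormedAddCommGroup E] [InnerProductSpace ℝ E]
    [FiniteDimensional ℝ E] {f : E → E} (hf : Continuous f) (hb : ∀ x, ‖f x‖ ≤ 1) :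
    ∃ x, f x = x := by
  -- Smooth approximations of `f` that stay in the ball have fixed points.
  have happ : ∀ ε > 0, ∃ x ∈ closedBall (0 : E) 1, ‖f x - x‖ < ε := by
    intro ε hε
    obtain ⟨g, hg⟩ := exists_contMDiffMap_forall_mem_convex_of_local_const (n := 1)
      (modelWithCornersSelf ℝ E) (t := fun x => ball (f x) ε ∩ closedBall (0 : E) 1)
      (fun x => (convex_ball _ _).inter (convex_closedBall _ _))
      (fun x => ⟨f x, by
        filter_upwards [hf.continuousAt.eventually (ball_mem_nhds (f x) hε)] with y hy
        exact ⟨by rw [mem_ball'] ; exact hy, by simpa using hb x⟩⟩)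
    obtain ⟨x, hx⟩ := exists_fixedPoint_of_contDiff g.contMDiff.contDiff
      (fun x => by simpa using (hg x).2)
    refine ⟨x, by simpa [hx] using (hg x).2, ?_⟩
    have := (hg x).1
    rw [hx, mem_ball'] at this
    rwa [← dist_eq_norm]
  obtain ⟨x, -, hmin⟩ := (isCompact_closedBall (0 : E) 1).exists_isMinOn ⟨0, by simp⟩
    (f := fun x => ‖f x - x‖) (by fun_prop)
  refine ⟨x, ?_⟩
  by_contra hne
  have hpos : 0 < ‖f x - x‖ := norm_pos_iff.mpr (sub_ne_zero.mpr hne)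
  obtain ⟨y, hy, hlt⟩ := happ _ hpos
  exact absurd (hmin hy) (not_le.mpr hlt)

/-- **Brouwer's fixed-point theorem** for the unit cube. -/
theorem exists_fixedPoint_cube {ι : Type*} [Fintype ι] {f : (ι → ℝ) → ι → ℝ}
    (hf : ContinuousOn f (Icc 0 1)) (hmaps : MapsTo f (Icc 0 1) (Icc 0 1)) :
    ∃ x ∈ Icc (0 : ι → ℝ) 1, f x = x := by
  set P : (ι → ℝ) → ι → ℝ := fun x => (x ⊔ 0) ⊓ 1 with hP
  have hPmem : ∀ x, P x ∈ Icc (0 : ι → ℝ) 1 := fun x =>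
    ⟨le_inf le_sup_right zero_le_one, inf_le_right⟩
  have hPc : Continuous P := continuous_pi fun i =>
    ((continuous_apply i).sup continuous_const).inf continuous_const
  have hPid : ∀ x ∈ Icc (0 : ι → ℝ) 1, P x = x := fun x hx => by
    simp only [hP]; rw [sup_eq_left.mpr hx.1, inf_eq_left.mpr hx.2]
  have hfP : Continuous fun x => f (P x) := hf.comp_continuous hPc hPmem
  set c : ℝ := Fintype.card ι + 1 with hc
  have hc0 : 0 < c := by positivity
  obtain ⟨x, hx⟩ := exists_fixedPoint_of_continuous (E := EuclideanSpace ℝ ι)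
    (f := fun x => c⁻¹ • WithLp.toLp 2 (f (P (c • WithLp.ofLp x))))
    (((PiLp.continuous_toLp 2 _).comp (hfP.comp
      ((PiLp.continuous_ofLp 2 _).const_smul c))).const_smul c⁻¹) (fun x => by
      have hm := hmaps (hPmem (c • WithLp.ofLp x))
      rw [norm_smul, Real.norm_of_nonneg (by positivity), inv_mul_le_iff₀ hc0, mul_one,
        EuclideanSpace.norm_eq, Real.sqrt_le_left hc0.le]
      calc ∑ i, ‖f (P (c • WithLp.ofLp x)) i‖ ^ 2 ≤ ∑ _i : ι, (1 : ℝ) := by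
            refine Finset.sum_le_sum fun i _ => ?_
            have h0 : 0 ≤ f (P (c • WithLp.ofLp x)) i := hm.1 i
            have h1 : f (P (c • WithLp.ofLp x)) i ≤ 1 := hm.2 i
            rw [Real.norm_of_nonneg h0]
            exact pow_le_one₀ h0 h1
        _ = Fintype.card ι := by simp
        _ ≤ c ^ 2 := by
            have : (0 : ℝ) ≤ Fintype.card ι := by positivity
            rw [hc]; nlinarith)
  set y : ι → ℝ := c • WithLp.ofLp x with hy
  have hfy : f (P y) = y := by
    have h1 : c • (c⁻¹ • WithLp.toLp 2 (f (P y))) = c • x := congrArg (c • ·) hx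
    rw [smul_inv_smul₀ hc0.ne'] at h1
    exact congrArg WithLp.ofLp h1
  have hym : y ∈ Icc (0 : ι → ℝ) 1 := hfy ▸ hmaps (hPmem y)
  exact ⟨y, hym, by rwa [hPid y hym] at hfy⟩

end Brouwer

/-! ### Rational-linear maps close to the identity -/

section RationalLinear

/-- The maps send the elements of a `ℚ`-basis of `ℝ` containing `1` to nearby rational numbers. -/
theorem exists_seq_ratLinear_tendsto_id :
    ∃ φ : ℕ → ℝ →ₗ[ℚ] ℝ, (∀ m y, ∃ q : ℚ, φ m y = q) ∧ (∀ m, φ m 1 = 1) ∧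
      ∀ y, Tendsto (fun m => φ m y) atTop (𝓝 y) := by
  classical
  have hli : LinearIndepOn ℚ id ({1} : Set ℝ) := by simp
  let b := Module.Basis.extend hli
  have hq : ∀ (m : ℕ) (x : ℝ), ∃ q : ℚ, |(q : ℝ) - x| < 1 / ((m : ℝ) + 1) := fun m x => by
    obtain ⟨q, h1, h2⟩ := exists_rat_btwn
      (show x < x + 1 / ((m : ℝ) + 1) by linarith [Nat.one_div_pos_of_nat (α := ℝ) (n := m)])
    exact ⟨q, by rw [abs_of_pos (by linarith)]; linarith⟩
  choose q hq using hq
  let q' : ℕ → ℝ → ℚ := fun m x => if x = 1 then 1 else q m x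
  have hq' : ∀ x, Tendsto (fun m => (q' m x : ℝ)) atTop (𝓝 x) := fun x => by
    by_cases hx : x = 1
    · simp [q', hx]
    · have h0 : Tendsto (fun m : ℕ => 1 / ((m : ℝ) + 1)) atTop (𝓝 0) :=
        tendsto_one_div_add_atTop_nhds_zero_nat
      rw [tendsto_iff_dist_tendsto_zero]
      refine squeeze_zero (fun _ => dist_nonneg) (fun m => ?_) h0
      simpa [q', hx, Real.dist_eq] using (hq m x).le
  refine ⟨fun m => b.constr ℚ fun x => (q' m x : ℝ), fun m y => ?_, fun m => ?_, fun y => ?_⟩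
  · refine ⟨(b.repr y).sum fun i a => a * q' m i, ?_⟩
    rw [Module.Basis.constr_apply, Finsupp.sum, Finsupp.sum]
    push_cast
    exact Finset.sum_congr rfl fun i _ => Rat.smul_def _ _
  · have h1 : (1 : ℝ) ∈ hli.extend (subset_univ _) := hli.subset_extend _ rfl
    have hb : b ⟨1, h1⟩ = 1 := Module.Basis.extend_apply_self hli _
    have := b.constr_basis ℚ (fun x => (q' m x : ℝ)) ⟨1, h1⟩
    rw [hb] at this
    rw [this]
    simp [q']
  · have hy : y = (b.repr y).sum fun i a => a • (i : ℝ) := by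
      conv_lhs => rw [← b.linearCombination_repr y]
      rw [Finsupp.linearCombination_apply]
      exact Finset.sum_congr rfl fun i _ => by
        change _ • b i = _ • (i : ℝ)
        rw [Module.Basis.extend_apply_self]
    simp only [Module.Basis.constr_apply]
    have hlim : Tendsto (fun m => (b.repr y).sum fun i a => a • (q' m i : ℝ)) atTop
        (𝓝 ((b.repr y).sum fun i a => a • (i : ℝ))) := by
      refine tendsto_finsetSum _ fun i _ => ?_
      simp only [Rat.smul_def]
      exact (hq' i).const_mul _
    rwa [← hy] at hlim

variable {φ : ℝ →ₗ[ℚ] ℝ}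

theorem ratLinear_apply_ratCast_mul (q : ℚ) (y : ℝ) : φ (q * y) = q * φ y := by
  rw [← Rat.smul_def, map_smul, Rat.smul_def]

theorem ratLinear_apply_ratCast (h1 : φ 1 = 1) (q : ℚ) : φ q = q := by
  have := ratLinear_apply_ratCast_mul (φ := φ) q 1
  rwa [mul_one, h1, mul_one] at this

end RationalLinear

/-! ### Existence of clearing vectors with prescribed coordinates -/

namespace FinancialSystem

variable {n : ℕ} (I : FinancialSystem n)

/-- The clearing equation of bank `i`. -/
def ClearsAt (r : Fin n → ℝ) (i : Fin n) : Prop :=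
  (0 < I.liabilities r i → r i = min 1 (I.assets r i / I.liabilities r i)) ∧
    (I.liabilities r i = 0 → r i = 1)

theorem isClearing_iff {r : Fin n → ℝ} :
    I.IsClearing r ↔ r ∈ Icc (0 : Fin n → ℝ) 1 ∧ ∀ i, I.ClearsAt r i :=
  ⟨fun h => ⟨⟨fun i => (h.1 i).1, fun i => (h.1 i).2⟩, h.2⟩,
    fun h => ⟨fun i => ⟨h.1.1 i, h.1.2 i⟩, h.2⟩⟩

variable {I}

section Nonneg

variable {r : Fin n → ℝ} (hr : r ∈ Icc (0 : Fin n → ℝ) 1)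
include hr

theorem debt_le_liabilityTo (i j : Fin n) : (I.debt i j : ℝ) ≤ I.liabilityTo r i j :=
  le_add_of_nonneg_right <| Finset.sum_nonneg fun k _ =>
    mul_nonneg (sub_nonneg.mpr (hr.2 k)) (by exact_mod_cast I.cds_nonneg i j k)

theorem liabilityTo_nonneg (i j : Fin n) : 0 ≤ I.liabilityTo r i j :=
  le_trans (by exact_mod_cast I.debt_nonneg i j) (debt_le_liabilityTo hr i j)

theorem liabilityTo_le_liabilities (i j : Fin n) : I.liabilityTo r i j ≤ I.liabilities r i :=
  Finset.single_le_sum (f := I.liabilityTo r i) (fun j _ => liabilityTo_nonneg hr i j)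
    (Finset.mem_univ j)

theorem liabilities_nonneg (i : Fin n) : 0 ≤ I.liabilities r i :=
  Finset.sum_nonneg fun j _ => liabilityTo_nonneg hr i j

theorem liabilities_pos {i j : Fin n} (h : 0 < I.debt i j) : 0 < I.liabilities r i :=
  lt_of_lt_of_le (by exact_mod_cast h)
    ((debt_le_liabilityTo hr i j).trans (liabilityTo_le_liabilities hr i j))

theorem ext_le_assets (i : Fin n) : (I.ext i : ℝ) ≤ I.assets r i :=
  le_add_of_nonneg_right <| Finset.sum_nonneg fun j _ =>
    mul_nonneg (hr.1 j) (liabilityTo_nonneg hr j i)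

theorem assets_nonneg (i : Fin n) : 0 ≤ I.assets r i :=
  le_trans (by exact_mod_cast I.ext_nonneg i) (ext_le_assets hr i)

end Nonneg

/-- Prescribed recovery rates on `S` extend to rates that satisfy all clearing equations
outside `S`. -/
theorem exists_clearsAt_compl (hI : I.IsNonDegenerate) {r₀ : Fin n → ℝ}
    (hr₀ : r₀ ∈ Icc (0 : Fin n → ℝ) 1) (S : Set (Fin n)) :
    ∃ r ∈ Icc (0 : Fin n → ℝ) 1, (∀ i ∈ S, r i = r₀ i) ∧ ∀ i ∉ S, I.ClearsAt r i := by
  classical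
  let inactive : Fin n → Prop := fun i => ∀ j, I.debt i j = 0 ∧ ∀ k, I.cds i j k = 0
  -- `min 1 (a / l) = a / max l a` for `l > 0`. The right-hand side is also continuous and equal to
  -- `1` at `l = 0`, because non-degeneracy keeps `max l a` positive.
  let f : (Fin n → ℝ) → Fin n → ℝ := fun r i =>
    if i ∈ S then r₀ i else if inactive i then 1 else
      I.assets r i / max (I.liabilities r i) (I.assets r i)
  have hpos : ∀ r ∈ Icc (0 : Fin n → ℝ) 1, ∀ i, ¬ inactive i →
      0 < max (I.liabilities r i) (I.assets r i) := by
    intro r hr i hi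
    have hcase : 0 < I.ext i ∨ ∃ j, 0 < I.debt i j := by
      simp only [inactive, not_forall, not_and_or] at hi
      obtain ⟨j, hj | ⟨k, hk⟩⟩ := hi
      · exact Or.inr ⟨j, (I.debt_nonneg i j).lt_of_ne' hj⟩
      · exact hI.1 i ⟨j, k, (I.cds_nonneg i j k).lt_of_ne' hk⟩
    rcases hcase with h | ⟨j, h⟩
    · exact lt_max_of_lt_right (lt_of_lt_of_le (by exact_mod_cast h) (ext_le_assets hr i))
    · exact lt_max_of_lt_left (liabilities_pos hr h)
  have hcl : ∀ i j, Continuous fun r => I.liabilityTo r i j := fun i j => by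
    unfold liabilityTo; fun_prop
  have hcL : ∀ i, Continuous fun r => I.liabilities r i := fun i =>
    continuous_finsetSum _ fun j _ => hcl i j
  have hcA : ∀ i, Continuous fun r => I.assets r i := fun i =>
    continuous_const.add (continuous_finsetSum _ fun j _ => (continuous_apply j).mul (hcl j i))
  have hfc : ContinuousOn f (Icc 0 1) := by
    refine continuousOn_pi.mpr fun i => ?_
    by_cases hiS : i ∈ S
    · simp only [f, hiS, if_true]; exact continuousOn_const
    by_cases hi : inactive i
    · simp only [f, hiS, hi, if_true, if_false]; exact continuousOn_const
    simp only [f, hiS, hi, if_false]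
    exact (hcA i).continuousOn.div ((hcL i).max (hcA i)).continuousOn
      fun r hr => (hpos r hr i hi).ne'
  have hfm : MapsTo f (Icc 0 1) (Icc 0 1) := by
    intro r hr
    have key : ∀ i, 0 ≤ f r i ∧ f r i ≤ 1 := by
      intro i
      simp only [f]
      split_ifs with h1 h2
      · exact ⟨hr₀.1 i, hr₀.2 i⟩
      · simp
      · have := hpos r hr i h2
        exact ⟨div_nonneg (assets_nonneg hr i) this.le,
          (div_le_one this).mpr (le_max_right _ _)⟩
    exact ⟨fun i => (key i).1, fun i => (key i).2⟩
  obtain ⟨r, hr, hfr⟩ := exists_fixedPoint_cube hfc hfm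
  refine ⟨r, hr, fun i hi => ?_, fun i hi => ?_⟩
  · rw [← hfr]; simp [f, hi]
  by_cases h2 : inactive i
  · have h1 : r i = 1 := by rw [← hfr]; simp [f, hi, h2]
    have h0 : I.liabilities r i = 0 := by
      refine Finset.sum_eq_zero fun j _ => ?_
      simp [liabilityTo, (h2 j).1, (h2 j).2]
    exact ⟨fun h => absurd h0 h.ne', fun _ => h1⟩
  · have h1 : r i = I.assets r i / max (I.liabilities r i) (I.assets r i) := by
      conv_lhs => rw [← hfr]
      simp [f, hi, h2]
    have hm := hpos r hr i h2
    refine ⟨fun h => ?_, fun h => ?_⟩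
    · rcases le_total (I.liabilities r i) (I.assets r i) with hle | hle
      · rw [max_eq_right hle] at h1 hm
        rw [h1, div_self hm.ne', min_eq_left ((one_le_div h).mpr hle)]
      · rw [max_eq_left hle] at h1
        rw [h1, min_eq_right ((div_le_one h).mpr hle)]
    · rw [h, max_eq_right (assets_nonneg hr i)] at h1 hm
      rw [h1, div_self hm.ne']

/-! ### Locality of the clearing equations -/

variable (I)

/-- There is an arc of some colour from `u` to `v`. -/
def Arc (u v : Fin n) : Prop := ∃ c, I.AuxArc c u v

/-- `S` contains every tail of an arc whose head lies in `S`. -/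
def IsPredClosed (S : Set (Fin n)) : Prop := ∀ ⦃u v⦄, I.Arc u v → v ∈ S → u ∈ S

variable {I}

theorem IsPredClosed.liabilityTo_congr {S : Set (Fin n)} (hS : I.IsPredClosed S)
    {r r' : Fin n → ℝ} (h : ∀ i ∈ S, r i = r' i) {i : Fin n} (hi : i ∈ S) (j : Fin n) :
    I.liabilityTo r i j = I.liabilityTo r' i j := by
  unfold liabilityTo
  congr 1
  refine Finset.sum_congr rfl fun k _ => ?_
  by_cases hk : I.cds i j k = 0
  · simp [hk]
  · rw [h k (hS ⟨.red, j, hk⟩ hi)]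

theorem liabilityTo_eq_zero {r : Fin n → ℝ} {i j : Fin n} (h : ¬ I.Arc i j) :
    I.liabilityTo r i j = 0 := by
  have h1 : I.debt i j = 0 := by
    by_contra hne; exact h ⟨.blue, hne⟩
  have h2 : ∀ k, I.cds i j k = 0 := fun k => by
    by_contra hne; exact h ⟨.orange, k, hne⟩
  simp [liabilityTo, h1, h2]

theorem IsPredClosed.clearsAt_congr {S : Set (Fin n)} (hS : I.IsPredClosed S)
    {r r' : Fin n → ℝ} (h : ∀ i ∈ S, r i = r' i) {i : Fin n} (hi : i ∈ S) :
    I.ClearsAt r i ↔ I.ClearsAt r' i := by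
  have h1 : I.liabilities r i = I.liabilities r' i :=
    Finset.sum_congr rfl fun j _ => hS.liabilityTo_congr h hi j
  have h2 : I.assets r i = I.assets r' i := by
    unfold assets payment
    congr 1
    refine Finset.sum_congr rfl fun j _ => ?_
    by_cases hj : I.Arc j i
    · have hjS := hS hj hi
      rw [h j hjS, hS.liabilityTo_congr h hjS]
    · rw [liabilityTo_eq_zero hj, liabilityTo_eq_zero hj, mul_zero, mul_zero]
  unfold ClearsAt
  rw [h1, h2, h i hi]

theorem debt_eq_zero_of_not_isSwitchedOn {u w : Fin n} (hred : I.AuxArc .red u w)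
    (hw : ¬ I.IsSwitchedOn w) (j : Fin n) : I.debt w j = 0 := by
  by_contra hne
  have h1 : 1 ≤ I.redInDegree w :=
    (Set.ncard_pos (Set.toFinite _)).mpr ⟨u, hred⟩
  rcases h1.lt_or_eq with h | h
  · exact hw (Or.inl h)
  · exact hw (Or.inr ⟨h.symm, j, hne⟩)

/-- A bank that is not switched on but is the debtor of a CDS distributes its total liabilities
in fixed proportions. -/
theorem liabilityTo_mul_eq_of_not_isSwitchedOn {u w : Fin n} (hred : I.AuxArc .red u w)
    (hw : ¬ I.IsSwitchedOn w) (r : Fin n → ℝ) (j : Fin n) :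
    I.liabilityTo r w j * ((∑ j, I.cds w j u : ℚ) : ℝ) = I.liabilities r w * I.cds w j u := by
  have hd : ∀ v, I.AuxArc .red v w → v = u := fun v hv => by
    by_contra hne
    refine hw (Or.inl ?_)
    exact (Set.one_lt_ncard_iff (Set.toFinite _)).mpr ⟨v, u, hv, hred, hne⟩
  have hl : ∀ j, I.liabilityTo r w j = (1 - r u) * I.cds w j u := fun j => by
    unfold liabilityTo
    rw [debt_eq_zero_of_not_isSwitchedOn hred hw j, Rat.cast_zero, zero_add]
    refine Finset.sum_eq_single u (fun k _ hk => ?_) (by simp)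
    have : I.cds w j k = 0 := by
      by_contra hne; exact hk (hd k ⟨j, hne⟩)
    simp [this]
  unfold liabilities
  simp only [hl]
  rw [← Finset.mul_sum]
  push_cast
  ring

/-! ### Transporting a clearing vector along a rational-linear map -/

theorem ClearsAt.mul_liabilities {r : Fin n → ℝ} (hr : r ∈ Icc (0 : Fin n → ℝ) 1) {i : Fin n}
    (h : I.ClearsAt r i) : r i * I.liabilities r i = min (I.liabilities r i) (I.assets r i) := by
  rcases (liabilities_nonneg hr i).eq_or_lt' with h0 | h0
  · rw [h0, mul_zero, min_eq_left (assets_nonneg hr i)]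
  · conv_lhs => rw [h.1 h0]
    rw [min_mul_of_nonneg _ _ h0.le, one_mul, div_mul_cancel₀ _ h0.ne']

variable (I)

/-- The recovery rates obtained from `r` by applying `φ` to the total payments and to the
total liabilities; as in a clearing vector, the rate of a bank without liabilities is `1`. -/
noncomputable def transport (φ : ℝ →ₗ[ℚ] ℝ) (r : Fin n → ℝ) (i : Fin n) : ℝ :=
  open Classical in
  if I.liabilities r i = 0 then 1 else φ (r i * I.liabilities r i) / φ (I.liabilities r i)

/-- `U` is closed under predecessors, and no red arc inside `U` whose tail is outside `S` has a
switched-on head. In the application `U` is the union of `S` and one strongly connected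
component. -/
structure IsSwitchFreeExtension (S U : Set (Fin n)) : Prop where
  isPredClosed : I.IsPredClosed U
  not_switchedOn : ∀ u ∈ U, u ∉ S → ∀ w ∈ U, I.AuxArc .red u w → ¬ I.IsSwitchedOn w

variable {I}

section Transport

variable {φ : ℝ →ₗ[ℚ] ℝ} (h1 : φ 1 = 1) {r : Fin n → ℝ} (hr : I.IsClearing r)
  {S U : Set (Fin n)} (hSU : I.IsSwitchFreeExtension S U) (hrat : ∀ i ∈ S, ∃ q : ℚ, r i = q)

theorem exists_rat_liabilityTo {i : Fin n} (hi : ∀ u, I.AuxArc .red u i → ∃ q : ℚ, r u = q)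
    (j : Fin n) : ∃ q : ℚ, I.liabilityTo r i j = q := by
  have : ∀ k, ∃ q : ℚ, (1 - r k) * (I.cds i j k : ℝ) = q := fun k => by
    by_cases hk : I.cds i j k = 0
    · exact ⟨0, by simp [hk]⟩
    · obtain ⟨q, hq⟩ := hi k ⟨j, hk⟩
      exact ⟨(1 - q) * I.cds i j k, by rw [hq]; push_cast; rfl⟩
  choose q hq using this
  exact ⟨I.debt i j + ∑ k, q k, by unfold liabilityTo; push_cast; simp [hq]⟩

theorem exists_rat_liabilities {i : Fin n} (hi : ∀ u, I.AuxArc .red u i → ∃ q : ℚ, r u = q) :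
    ∃ q : ℚ, I.liabilities r i = q := by
  choose q hq using exists_rat_liabilityTo hi
  exact ⟨∑ j, q j, by unfold liabilities; push_cast; simp [hq]⟩

include h1 hr in
theorem transport_eq_of_rat {i : Fin n} (hi : ∀ u, I.AuxArc .red u i → ∃ q : ℚ, r u = q) :
    I.transport φ r i = φ (r i) := by
  unfold transport
  split_ifs with h0
  · rw [(hr.2 i).2 h0, h1]
  · obtain ⟨q, hq⟩ := exists_rat_liabilities hi
    rw [hq] at h0 ⊢
    rw [mul_comm, ratLinear_apply_ratCast_mul, ratLinear_apply_ratCast h1,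
      mul_div_cancel_left₀ _ h0]

include hSU hrat in
/-- Either the liabilities of a bank in `U` are rational, or the bank pays in fixed proportions. -/
theorem IsSwitchFreeExtension.rat_or_not_switchedOn {i : Fin n} (hi : i ∈ U) :
    (∀ u, I.AuxArc .red u i → ∃ q : ℚ, r u = q) ∨
      ∃ u, I.AuxArc .red u i ∧ ¬ I.IsSwitchedOn i := by
  by_cases h : ∃ u, I.AuxArc .red u i ∧ u ∉ S
  · obtain ⟨u, hu, huS⟩ := h
    exact Or.inr ⟨u, hu, hSU.not_switchedOn u (hSU.isPredClosed ⟨_, hu⟩ hi) huS i hi hu⟩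
  · push Not at h
    exact Or.inl fun u hu => hrat u (h u hu)

include h1 hr hSU hrat in
/-- A reference bank is the debtor of a debt contract, so its liabilities are rational. -/
theorem transport_reference (hI : I.IsNonDegenerate) {i j k : Fin n} (hi : i ∈ U)
    (hk : I.cds i j k ≠ 0) : I.transport φ r k = φ (r k) := by
  have hkU : k ∈ U := hSU.isPredClosed ⟨.red, j, hk⟩ hi
  rcases hSU.rat_or_not_switchedOn hrat hkU with h | ⟨u, hu, hns⟩
  · exact transport_eq_of_rat h1 hr h
  · obtain ⟨v, hv⟩ := hI.2 k ⟨i, j, (I.cds_nonneg i j k).lt_of_ne' hk⟩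
    exact absurd (debt_eq_zero_of_not_isSwitchedOn hu hns v) hv.ne'

include h1 hr hSU hrat in
theorem liabilityTo_transport (hI : I.IsNonDegenerate) {i : Fin n} (hi : i ∈ U) (j : Fin n) :
    I.liabilityTo (I.transport φ r) i j = φ (I.liabilityTo r i j) := by
  unfold liabilityTo
  rw [map_add, map_sum, ratLinear_apply_ratCast h1]
  congr 1
  refine Finset.sum_congr rfl fun k _ => ?_
  rw [mul_comm (1 - r k), ratLinear_apply_ratCast_mul, map_sub, h1]
  by_cases hk : I.cds i j k = 0
  · simp [hk]
  · rw [transport_reference h1 hr hSU hrat hI hi hk, mul_comm]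

include h1 hr hSU hrat in
theorem liabilities_transport (hI : I.IsNonDegenerate) {i : Fin n} (hi : i ∈ U) :
    I.liabilities (I.transport φ r) i = φ (I.liabilities r i) := by
  unfold liabilities
  rw [map_sum]
  exact Finset.sum_congr rfl fun j _ => liabilityTo_transport h1 hr hSU hrat hI hi j

include h1 hr hSU hrat in
theorem transport_mul_liabilities (hI : I.IsNonDegenerate)
    (hφ : ∀ i, 0 < I.liabilities r i → 0 < φ (I.liabilities r i)) {i : Fin n} (hi : i ∈ U) :
    I.transport φ r i * I.liabilities (I.transport φ r) i = φ (r i * I.liabilities r i) := by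
  rw [liabilities_transport h1 hr hSU hrat hI hi]
  rcases (liabilities_nonneg (I.isClearing_iff.mp hr).1 i).eq_or_lt' with h0 | h0
  · rw [h0, mul_zero, map_zero, mul_zero]
  · rw [transport, if_neg h0.ne', div_mul_cancel₀ _ (hφ i h0).ne']

include h1 hr hSU hrat in
theorem payment_transport (hI : I.IsNonDegenerate)
    (hφ : ∀ i, 0 < I.liabilities r i → 0 < φ (I.liabilities r i)) {i : Fin n} (hi : i ∈ U)
    (j : Fin n) : I.payment (I.transport φ r) i j = φ (I.payment r i j) := by
  unfold payment
  rcases hSU.rat_or_not_switchedOn hrat hi with h | ⟨u, hu, hns⟩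
  · obtain ⟨q, hq⟩ := exists_rat_liabilityTo h j
    rw [transport_eq_of_rat h1 hr h, liabilityTo_transport h1 hr hSU hrat hI hi, hq,
      ratLinear_apply_ratCast h1, mul_comm (r i), ratLinear_apply_ratCast_mul, mul_comm]
  · set C : ℚ := ∑ j, I.cds i j u with hC
    have hCpos : 0 < C := by
      obtain ⟨v, hv⟩ := hu
      exact lt_of_lt_of_le ((I.cds_nonneg i v u).lt_of_ne' hv)
        (Finset.single_le_sum (f := fun j => I.cds i j u) (fun j _ => I.cds_nonneg i j u)
          (Finset.mem_univ v))
    have hC0 : (C : ℝ) ≠ 0 := by exact_mod_cast hCpos.ne'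
    have key : ∀ s : Fin n → ℝ, s i * I.liabilityTo s i j =
        ((I.cds i j u / C : ℚ) : ℝ) * (s i * I.liabilities s i) := fun s => by
      have := liabilityTo_mul_eq_of_not_isSwitchedOn hu hns s j
      push_cast
      field_simp
      rw [← hC] at this
      linear_combination (s i) * this
    rw [key, key, ratLinear_apply_ratCast_mul,
      transport_mul_liabilities h1 hr hSU hrat hI hφ hi]

include h1 hr hSU hrat in
theorem assets_transport (hI : I.IsNonDegenerate)
    (hφ : ∀ i, 0 < I.liabilities r i → 0 < φ (I.liabilities r i)) {i : Fin n} (hi : i ∈ U) :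
    I.assets (I.transport φ r) i = φ (I.assets r i) := by
  unfold assets
  rw [map_add, map_sum, ratLinear_apply_ratCast h1]
  congr 1
  refine Finset.sum_congr rfl fun j _ => ?_
  by_cases hj : I.Arc j i
  · exact payment_transport h1 hr hSU hrat hI hφ (hSU.isPredClosed hj hi) i
  · simp [payment, liabilityTo_eq_zero hj]

/-- If `φ` does not reverse the order between liabilities and assets, it carries solutions of the
clearing equations on `U` to solutions. -/
theorem clearsAt_transport (h1 : φ 1 = 1) (hr : I.IsClearing r)
    (hSU : I.IsSwitchFreeExtension S U) (hrat : ∀ i ∈ S, ∃ q : ℚ, r i = q)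
    (hI : I.IsNonDegenerate)
    (hφ : ∀ i, 0 < I.liabilities r i → 0 < φ (I.liabilities r i))
    (hle : ∀ i, I.liabilities r i ≤ I.assets r i → φ (I.liabilities r i) ≤ φ (I.assets r i))
    (hge : ∀ i, I.assets r i ≤ I.liabilities r i → φ (I.assets r i) ≤ φ (I.liabilities r i))
    {i : Fin n} (hi : i ∈ U) : I.ClearsAt (I.transport φ r) i := by
  have hr' := (I.isClearing_iff.mp hr).1
  unfold ClearsAt
  rw [liabilities_transport h1 hr hSU hrat hI hi, assets_transport h1 hr hSU hrat hI hφ hi]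
  rcases (liabilities_nonneg hr' i).eq_or_lt' with h0 | h0
  · rw [h0, map_zero]
    exact ⟨fun h => absurd h (lt_irrefl _), fun _ => by simp [transport, h0]⟩
  · have hp := hφ i h0
    refine ⟨fun _ => ?_, fun h => absurd h hp.ne'⟩
    rw [transport, if_neg h0.ne', ClearsAt.mul_liabilities hr' (hr.2 i)]
    rcases le_total (I.liabilities r i) (I.assets r i) with h | h
    · rw [min_eq_left h, div_self hp.ne', min_eq_left ((one_le_div hp).mpr (hle i h))]
    · rw [min_eq_right h, min_eq_right ((div_le_one hp).mpr (hge i h))]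

end Transport

/-- A clearing vector that is rational on `S` can be approximated on `U` by the coordinates of
clearing vectors that are rational on `U`. -/
theorem exists_isClearing_rat_near (hI : I.IsNonDegenerate) {r : Fin n → ℝ}
    (hr : I.IsClearing r) {S U : Set (Fin n)} (hSU : I.IsSwitchFreeExtension S U)
    (hrat : ∀ i ∈ S, ∃ q : ℚ, r i = q) {ε : ℝ} (hε : 0 < ε) :
    ∃ r', I.IsClearing r' ∧ ∀ i ∈ U, (∃ q : ℚ, r' i = q) ∧ |r' i - r i| < ε := by
  have hr' := (I.isClearing_iff.mp hr).1
  obtain ⟨φ, hφq, hφ1, hφlim⟩ := exists_seq_ratLinear_tendsto_id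
  have hpos : ∀ y : ℝ, 0 ≤ y → ∀ᶠ m in atTop, 0 ≤ φ m y ∧ (0 < y → 0 < φ m y) := fun y hy => by
    rcases hy.eq_or_lt' with rfl | hy
    · simp
    · filter_upwards [(hφlim y).eventually (lt_mem_nhds hy)] with m hm
      exact ⟨hm.le, fun _ => hm⟩
  have hL : ∀ᶠ m in atTop, ∀ i, 0 < I.liabilities r i → 0 < φ m (I.liabilities r i) :=
    eventually_all.mpr fun i => (hpos _ (liabilities_nonneg hr' i)).mono fun _ h => h.2
  have hA : ∀ᶠ m in atTop, ∀ i, 0 ≤ φ m (I.assets r i) :=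
    eventually_all.mpr fun i => (hpos _ (assets_nonneg hr' i)).mono fun _ h => h.1
  have hmono : ∀ y z : ℝ, ∀ᶠ m in atTop, y ≤ z → φ m y ≤ φ m z := fun y z => by
    by_cases h : y ≤ z
    · refine (hpos (z - y) (sub_nonneg.mpr h)).mono fun m hm _ => ?_
      have := hm.1
      rw [map_sub] at this
      linarith
    · exact Eventually.of_forall fun _ h' => absurd h' h
  have hle : ∀ᶠ m in atTop, ∀ i, I.liabilities r i ≤ I.assets r i →
      φ m (I.liabilities r i) ≤ φ m (I.assets r i) := eventually_all.mpr fun i => hmono _ _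
  have hge : ∀ᶠ m in atTop, ∀ i, I.assets r i ≤ I.liabilities r i →
      φ m (I.assets r i) ≤ φ m (I.liabilities r i) := eventually_all.mpr fun i => hmono _ _
  have hnear : ∀ᶠ m in atTop, ∀ i, |I.transport (φ m) r i - r i| < ε := by
    refine eventually_all.mpr fun i => ?_
    have ht : Tendsto (fun m => I.transport (φ m) r i) atTop (𝓝 (r i)) := by
      unfold transport
      split_ifs with h0
      · rw [(hr.2 i).2 h0]; exact tendsto_const_nhds
      · have := (hφlim (r i * I.liabilities r i)).div (hφlim _) h0
        rwa [mul_div_cancel_right₀ _ h0] at this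
    exact ht.eventually (Metric.ball_mem_nhds _ hε)
  obtain ⟨m, hL, hA, hle, hge, hnear⟩ :=
    (hL.and (hA.and (hle.and (hge.and hnear)))).exists
  have hbox : I.transport (φ m) r ∈ Icc (0 : Fin n → ℝ) 1 := by
    have : ∀ i, 0 ≤ I.transport (φ m) r i ∧ I.transport (φ m) r i ≤ 1 := fun i => by
      unfold transport
      split_ifs with h0
      · simp
      · have hl := hL i ((liabilities_nonneg hr' i).lt_of_ne' h0)
        rw [ClearsAt.mul_liabilities hr' (hr.2 i)]
        rcases le_total (I.liabilities r i) (I.assets r i) with h | h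
        · rw [min_eq_left h, div_self hl.ne']; simp
        · rw [min_eq_right h]
          exact ⟨div_nonneg (hA i) hl.le, (div_le_one hl).mpr (hge i h)⟩
    exact ⟨fun i => (this i).1, fun i => (this i).2⟩
  obtain ⟨r', hr'box, heq, hout⟩ := exists_clearsAt_compl hI hbox U
  refine ⟨r', I.isClearing_iff.mpr ⟨hr'box, fun i => ?_⟩, fun i hi => ?_⟩
  · by_cases hi : i ∈ U
    · exact (hSU.isPredClosed.clearsAt_congr heq hi).mpr
        (clearsAt_transport (hφ1 m) hr hSU hrat hI hL hle hge hi)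
    · exact hout i hi
  · rw [heq i hi]
    refine ⟨?_, hnear i⟩
    unfold transport
    split_ifs with h0
    · exact ⟨1, by simp⟩
    · obtain ⟨p, hp⟩ := hφq m (r i * I.liabilities r i)
      obtain ⟨q, hq⟩ := hφq m (I.liabilities r i)
      exact ⟨p / q, by rw [hp, hq]; push_cast; rfl⟩

/-! ### Induction along the auxiliary graph -/

/-- A directed walk of minimal length visits each node at most once. -/
theorem exists_injective_walk {α : Type*} {R : α → α → Prop} {a b : α}
    (h : Relation.ReflTransGen R a b) :
    ∃ (m : ℕ) (f : ℕ → α), f 0 = a ∧ f m = b ∧ (∀ t < m, R (f t) (f (t + 1))) ∧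
      Set.InjOn f (Set.Iic m) := by
  classical
  have hex : ∃ m, ∃ f : ℕ → α, f 0 = a ∧ f m = b ∧ ∀ t < m, R (f t) (f (t + 1)) := by
    induction h with
    | refl => exact ⟨0, fun _ => a, rfl, rfl, by simp⟩
    | @tail c d _ hcd ih =>
      obtain ⟨m, f, h0, hm, hf⟩ := ih
      refine ⟨m + 1, fun t => if t ≤ m then f t else d, by simpa using h0, by simp, ?_⟩
      intro t ht
      rcases (Nat.lt_succ_iff.mp ht).eq_or_lt with rfl | h'
      · simpa [hm] using hcd
      · simpa [h'.le, Nat.succ_le_of_lt h'] using hf t h'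
  obtain ⟨f, h0, hm, hf⟩ := Nat.find_spec hex
  refine ⟨Nat.find hex, f, h0, hm, hf, ?_⟩
  have hlt : ∀ i j, i < j → j ≤ Nat.find hex → f i ≠ f j := by
    intro i j hij hj he
    -- Cut out the part of the walk between the two visits.
    refine Nat.find_min hex (m := Nat.find hex - (j - i)) (by omega)
      ⟨fun t => if t ≤ i then f t else f (t + (j - i)), by simpa using h0, ?_, ?_⟩
    · by_cases hji : Nat.find hex - (j - i) ≤ i
      · have h2 : j = Nat.find hex := by omega
        have h3 : Nat.find hex - (j - i) = i := by omega
        simp only [h3, le_refl, if_true]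
        rw [he, h2, hm]
      · simp only [hji, if_false]
        rw [Nat.sub_add_cancel (by omega), hm]
    · intro t ht
      rcases lt_trichotomy t i with h | rfl | h
      · simpa [h.le, Nat.succ_le_of_lt h] using hf t (by omega)
      · have := hf j (by omega)
        simp only [le_refl, if_true, Nat.not_succ_le_self, if_false]
        rw [he]
        convert this using 2
        omega
      · have := hf (t + (j - i)) (by omega)
        simp only [not_le.mpr h, not_le.mpr (h.trans (Nat.lt_succ_self t)), if_false]
        convert this using 2
        omega
  intro i hi j hj he
  rcases lt_trichotomy i j with h | h | h
  · exact absurd he (hlt i j h hj)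
  · exact h
  · exact absurd he.symm (hlt j i h hi)

/-- A red arc with switched-on head is part of a weakly switched cycle as soon as its tail can be
reached from its head. -/
theorem exists_isWeaklySwitched {u w : Fin n} (hred : I.AuxArc .red u w)
    (hw : I.IsSwitchedOn w) (h : Relation.ReflTransGen I.Arc w u) :
    ∃ C : I.AuxCycle, C.IsWeaklySwitched := by
  obtain ⟨m, f, h0, hm, hf, hinj⟩ := exists_injective_walk h
  choose c hc using hf
  have harc : ∀ t : Fin (m + 1), I.AuxArc (if ht : (t : ℕ) < m then c t ht else .red)
      (f t) (f (t + 1 : Fin (m + 1))) := by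
    intro t
    by_cases ht : (t : ℕ) < m
    · have : ((t + 1 : Fin (m + 1)) : ℕ) = t + 1 := Fin.val_add_one_of_lt (by
        rw [Fin.lt_def]; simpa using ht)
      rw [dif_pos ht, this]
      exact hc t ht
    · have : t = Fin.last m := Fin.ext (by have := t.2; simp; omega)
      subst this
      rw [dif_neg ht, Fin.last_add_one, Fin.val_last, Fin.val_zero, hm, h0]
      exact hred
  refine ⟨⟨m, fun t => f t, _, fun s t hst => Fin.ext
    (hinj (Nat.lt_succ_iff.mp s.2) (Nat.lt_succ_iff.mp t.2) hst), harc⟩, Fin.last m, ?_, ?_⟩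
  · simp
  · simpa [Fin.last_add_one, h0] using hw

/-- Induction along the strongly connected components of the auxiliary graph. -/
theorem isSwitchFreeExtension_induction (hcyc : ¬ ∃ C : I.AuxCycle, C.IsWeaklySwitched)
    {Q : Set (Fin n) → Prop} (hempty : Q ∅)
    (hstep : ∀ S U, I.IsSwitchFreeExtension S U → Q S → Q U) : Q univ := by
  classical
  let anc : Fin n → Set (Fin n) := fun v => {u | Relation.ReflTransGen I.Arc u v}
  have key : ∀ (N : ℕ) (S : Set (Fin n)), I.IsPredClosed S → Sᶜ.ncard = N → Q S → Q univ := by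
    intro N
    induction N using Nat.strong_induction_on with
    | _ N ih =>
    intro S hS hN hQ
    by_cases hne : Sᶜ = ∅
    · rwa [compl_empty_iff.mp hne] at hQ
    -- A bank outside `S` with as few ancestors outside `S` as possible lies in a component all of
    -- whose other predecessors belong to `S`.
    obtain ⟨v, hv, hmin⟩ := Set.exists_min_image Sᶜ (fun v => (anc v \ S).ncard) (toFinite _)
      (nonempty_iff_ne_empty.mpr hne)
    have hU : I.IsPredClosed (S ∪ anc v) := by
      rintro a b hab (hb | hb)
      · exact Or.inl (hS hab hb)
      · exact Or.inr (Relation.ReflTransGen.head hab hb)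
    -- By minimality every bank of `anc v \ S` is reachable from `v`.
    have hback : ∀ u ∈ anc v, u ∉ S → Relation.ReflTransGen I.Arc v u := by
      intro u hu huS
      have hsub : anc u \ S ⊆ anc v \ S := fun x hx => ⟨hx.1.trans hu, hx.2⟩
      have heq := Set.eq_of_subset_of_ncard_le hsub (hmin u huS) (toFinite _)
      have : v ∈ anc u \ S := heq ▸ ⟨Relation.ReflTransGen.refl, hv⟩
      exact this.1
    have hext : I.IsSwitchFreeExtension S (S ∪ anc v) := by
      refine ⟨hU, fun u hu huS w hw hred hsw => ?_⟩
      have huv : u ∈ anc v := hu.resolve_left huS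
      have hwS : w ∉ S := fun h => huS (hS ⟨_, hred⟩ h)
      have hwv : w ∈ anc v := hw.resolve_left hwS
      exact hcyc (exists_isWeaklySwitched hred hsw (hwv.trans (hback u huv huS)))
    refine ih _ ?_ (S ∪ anc v) hU rfl (hstep _ _ hext hQ)
    rw [← hN]
    refine Set.ncard_lt_ncard ?_ (toFinite _)
    refine (ssubset_iff_of_subset (compl_subset_compl.mpr subset_union_left)).mpr ⟨v, hv, ?_⟩
    exact fun h => h (Or.inr Relation.ReflTransGen.refl)
  exact key _ ∅ (fun _ _ _ h => h.elim) rfl hempty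

end FinancialSystem

end

/-! ### Rationality of clearing vectors -/

theorem mainTheorem3 {n : ℕ} (I : FinancialSystem n) (hI : I.IsNonDegenerate)
    (hcyc : ¬ ∃ C : I.AuxCycle, C.IsWeaklySwitched) :
    (∃ r : Fin n → ℝ, I.IsClearing r ∧ IsRationalVector r) ∧
    ({r : Fin n → ℝ | I.IsClearing r}.Finite →
      ∀ r : Fin n → ℝ, I.IsClearing r → IsRationalVector r) := by
  constructor
  · have h := FinancialSystem.isSwitchFreeExtension_induction hcyc
      (Q := fun S => ∃ r, I.IsClearing r ∧ ∀ i ∈ S, ∃ q : ℚ, r i = q) ?_ ?_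
    · obtain ⟨r, hr, hq⟩ := h
      exact ⟨r, hr, fun i => hq i (Set.mem_univ i)⟩
    · obtain ⟨r, hr, -, h⟩ := FinancialSystem.exists_clearsAt_compl hI
        (r₀ := 0) ⟨le_rfl, zero_le_one⟩ ∅
      exact ⟨r, I.isClearing_iff.mpr ⟨hr, fun i => h i (Set.notMem_empty i)⟩, by simp⟩
    · rintro S U hSU ⟨r, hr, hq⟩
      obtain ⟨r', hr', h⟩ := FinancialSystem.exists_isClearing_rat_near hI hr hSU hq one_pos
      exact ⟨r', hr', fun i hi => (h i hi).1⟩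
  · intro hfin r hr i
    refine FinancialSystem.isSwitchFreeExtension_induction hcyc
      (Q := fun S => ∀ r, I.IsClearing r → ∀ i ∈ S, ∃ q : ℚ, r i = q) (by simp) ?_
      r hr i (Set.mem_univ i)
    intro S U hSU hQ r hr i hi
    -- The rational values at `i` form a finite, hence closed, set whose closure contains `r i`.
    have hfin' : {x : ℝ | ∃ r', I.IsClearing r' ∧ r' i = x ∧ ∃ q : ℚ, x = q}.Finite := by
      refine (hfin.image fun r' => r' i).subset ?_
      rintro x ⟨r', hr', hx, -⟩
      exact ⟨r', hr', hx⟩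
    have hmem : r i ∈ closure {x : ℝ | ∃ r', I.IsClearing r' ∧ r' i = x ∧ ∃ q : ℚ, x = q} := by
      refine Metric.mem_closure_iff.mpr fun ε hε => ?_
      obtain ⟨r', hr', h⟩ :=
        FinancialSystem.exists_isClearing_rat_near hI hr hSU (hQ r hr) hε
      exact ⟨r' i, ⟨r', hr', rfl, (h i hi).1⟩, by rw [dist_comm]; exact (h i hi).2⟩
    rw [hfin'.isClosed.closure_eq] at hmem
    obtain ⟨-, -, -, hq⟩ := hmem
    exact hq
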